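/- Let $d\ge 0$. All homeomorphisms below are piecewise linear (PL): a homeomorphism $\varphi:X\to Y$ between subsets of Euclidean spaces is PL if $X$ is the union of a family of compact convex polytopes, locally finite in $X$, on each of which $\varphi$ is affine. If $M\subseteq\mathbb R^d$ is PL-homeomorphic to $\mathbb R^{k+1}$, a *pseudohyperplane in $M$* is a relatively closed subset $H\subseteq M$ that is PL-homeomorphic to $\mathbb R^{k}$; its two *sides* $H^+,H^-$ are the two connected components of $M\setminus H$. For $M=\mathbb R^d$ the sets $H\cup H^+$ and $H\cup H^-$ are the *closed sides*, or *closed pseudohalfspaces*, of $H$. A *ball* is a set PL-homeomorphic to some $\mathbb R^k$ or to a closed half-space of some $\mathbb R^{k+1}$. A finite family $(H_e)_{e\in E}$ of pseudohyperplanes in $\mathbb R^d$ is an *arrangement of (linear) pseudohyperplanes* if, with $H_A:=\bigcap_{e\in A}H_e$ for $A\subseteq E$ (and $H_\emptyset=\mathbb R^d$): 1. for every non-empty $A\subseteq E$, $H_A$ is PL-homeomorphic to $\mathbb R^k$ for some $k<d$; 2. if $A\subseteq E$, $e\in E$ and $H_A\not\subseteq H_e$, then $H_A\cap H_e$ is a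 pseudohyperplane in $H_A$ with sides $H_A\cap H_e^+$ and $H_A\cap H_e^-$; 3. the intersection of an arbitrary collection of closed sides of members of the family is a ball. A finite family $(H_e)_{e\in E}$ of pseudohyperplanes in $\mathbb R^d$ is an *arrangement of affine pseudohyperplanes* if for every $A\subseteq E$ either $\bigcap_{e\in A}H_e=\emptyset$ or $(H_e)_{e\in A}$ is an arrangement of linear pseudohyperplanes. **Proposition.** Let $(H_e)_{e\in E}$ be an arrangement of affine pseudohyperplanes in $\mathbb R^d$. Then the intersection of any collection of closed pseudohalfspaces of members of the arrangement is path-connected whenever it is non-empty. -/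

import Mathlib

open Set

/-- The Euclidean space `ℝ^d`. -/
abbrev Eucl (d : ℕ) : Type := EuclideanSpace ℝ (Fin d)

/-- The subsets `X ⊆ ℝ^m` and `Y ⊆ ℝ^n` are piecewise-linearly homeomorphic: there is a
homeomorphism `φ : X → Y` and a family of (compact, convex) polytopes, locally finite in `X`, with
union `X`, such that `φ` is affine on each polytope of the family. (The images of the polytopes
then form such a family for the inverse of `φ`, so that this is a symmetric relation.) -/
def PLHomeomorphic {m n : ℕ} (X : Set (Eucl m)) (Y : Set (Eucl n)) : Prop :=
  ∃ φ : X ≃ₜ Y, ∃ 𝒞 : Set (Set (Eucl m)),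
    (∀ C ∈ 𝒞, ∃ s : Finset (Eucl m), C = convexHull ℝ (s : Set (Eucl m))) ∧
    ⋃₀ 𝒞 = X ∧
    LocallyFinite (fun C : 𝒞 => ((↑) : X → Eucl m) ⁻¹' (C : Set (Eucl m))) ∧
    ∀ C ∈ 𝒞, ∃ g : Eucl m →ᵃ[ℝ] Eucl n, ∀ x : X, (x : Eucl m) ∈ C → (φ x : Eucl n) = g x

/-- `X` is PL-homeomorphic to the linear space `ℝ^k`. -/
def IsPLSpace {d : ℕ} (k : ℕ) (X : Set (Eucl d)) : Prop :=
  PLHomeomorphic X (univ : Set (Eucl k))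

/-- `X` is a PL ball in the sense appropriate to the non-compact space `ℝ^d` (a closed ball whose
boundary lies at infinity, completely or in part): it is PL-homeomorphic to some `ℝ^k` or
to a closed half-space of some `ℝ^(k+1)`. All intersections of closed linear half-spaces are of
this form. -/
def IsPLBall {d : ℕ} (X : Set (Eucl d)) : Prop :=
  (∃ k : ℕ, IsPLSpace k X) ∨
    ∃ k : ℕ, PLHomeomorphic X {x : Eucl (k + 1) | 0 ≤ x 0}

/-- `H` is a pseudohyperplane in `M`, where `M` is PL-homeomorphic to some `ℝ^(k+1)`: a relatively
closed subset of `M` that is PL-homeomorphic to a linear hyperplane, that is, to `ℝ^k`.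
For `M = univ` this says that `H` is a pseudohyperplane in `ℝ^d`, and then `k + 1 = d`. -/
def IsPseudohyperplaneIn {d : ℕ} (M H : Set (Eucl d)) : Prop :=
  H ⊆ M ∧ M ∩ closure H ⊆ H ∧ ∃ k : ℕ, IsPLSpace (k + 1) M ∧ IsPLSpace k H

/-- The (open) sides of `H` in `M`: the connected components of `M \ H`. -/
def sides {d : ℕ} (M H : Set (Eucl d)) : Set (Set (Eucl d)) :=
  {C | ∃ x ∈ M \ H, C = connectedComponentIn (M \ H) x}

/-- `H` has exactly two sides in `M`, namely `P` and `N`. -/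
def AreTheTwoSides {d : ℕ} (M H P N : Set (Eucl d)) : Prop :=
  P ≠ N ∧ sides M H = {P, N}

/-- `S` is a closed side of `H` in `ℝ^d`, also called a closed pseudohalfspace of `H`: the union
of `H` and one of its sides. -/
def IsClosedSide {d : ℕ} (H S : Set (Eucl d)) : Prop :=
  ∃ C ∈ sides univ H, S = H ∪ C

/-- The intersection `H_A` of the members of the family `H` with index in `A`;
it is `ℝ^d` if `A` is empty. -/
def flat {d : ℕ} {ι : Type*} (H : ι → Set (Eucl d)) (A : Set ι) : Set (Eucl d) :=
  ⋂ e ∈ A, H e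

/-- Arrangements of (linear) pseudohyperplanes in `ℝ^d`. -/
structure IsLinearArrangement {d : ℕ} {ι : Type*} (H : ι → Set (Eucl d)) : Prop where
  finite : Finite ι
  pseudohyperplane : ∀ e, IsPseudohyperplaneIn univ (H e)
  /-- Every `H_A` is a pseudohyperplane of smaller dimension. -/
  flat_space : ∀ A : Set ι, A.Nonempty → ∃ k < d, IsPLSpace k (flat H A)
  /-- If `H_A ⊄ H_e`, then `H_A ∩ H_e` is a pseudohyperplane in `H_A`, and its two sides are the
  intersections of `H_A` with the two sides of `H_e`. -/
  flat_inter : ∀ (A : Set ι) (e : ι), ¬ flat H A ⊆ H e →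
    IsPseudohyperplaneIn (flat H A) (flat H A ∩ H e) ∧
      ∀ P N : Set (Eucl d), AreTheTwoSides univ (H e) P N →
        AreTheTwoSides (flat H A) (flat H A ∩ H e) (flat H A ∩ P) (flat H A ∩ N)
  /-- The intersection of an arbitrary collection of closed sides is a ball. -/
  ball : ∀ 𝒮 : Set (Set (Eucl d)), (∀ S ∈ 𝒮, ∃ e, IsClosedSide (H e) S) → IsPLBall (⋂₀ 𝒮)

/-- Arrangements of affine pseudohyperplanes in `ℝ^d`: finite families of pseudohyperplanes such
that every subfamily has empty intersection or is an arrangement of linear pseudohyperplanes. -/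
structure IsAffineArrangement {d : ℕ} {ι : Type*} (H : ι → Set (Eucl d)) : Prop where
  finite : Finite ι
  pseudohyperplane : ∀ e, IsPseudohyperplaneIn univ (H e)
  subfamily : ∀ A : Set ι, flat H A = ∅ ∨ IsLinearArrangement (fun e : A => H e)

/-!
Only two facts about an affine arrangement matter: each `H e` is closed, and each flat is empty or
path-connected, being homeomorphic to some `ℝ^k`. The lemma that carries the proof is
`IsPathConnected.inter_union_component`: if `X` is path-connected, `H` is closed, `X ∩ H` is empty
or path-connected and `C` is a component of the complement of `H`, then `X ∩ (H ∪ C)` is empty or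
path-connected. Indeed, a path in `X` that starts in `H ∪ C` cannot leave `H ∪ C` before it meets
`H`; so two points of `X ∩ (H ∪ C)` are joined either by a path in `X` that misses `H`, or by
going from each of them to `H` and connecting the end points inside `X ∩ H`.

By induction on the number of closed sides in a finite family `𝒯`, every set
`flat H A ∩ ⋂₀ 𝒯` is empty or path-connected: when `X = flat H A ∩ ⋂₀ 𝒯` is cut by a closed side
of `H e`, both `X` and `X ∩ H e = flat H (insert e A) ∩ ⋂₀ 𝒯` are covered by the induction
hypothesis. Finally, two different closed sides of the same `H e` intersect in `H e`, so an
arbitrary intersection of closed sides is of the form `flat H A ∩ ⋂₀ 𝒯` with `𝒯` finite. That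
pseudohyperplanes have exactly two sides plays no role.
-/

/-- A path in `X` from a point of `H ∪ C` to a point of `H` stays in `H ∪ C` up to the first time
at which it meets `H`. -/
theorem JoinedIn.exists_joinedIn_inter_union_component {Y : Type*} [TopologicalSpace Y]
    {X H : Set Y} (hH : IsClosed H) {x w z : Y} (h : JoinedIn X x w) (hw : w ∈ H)
    (hx : x ∈ H ∪ connectedComponentIn (univ \ H) z) :
    ∃ a ∈ X ∩ H, JoinedIn (X ∩ (H ∪ connectedComponentIn (univ \ H) z)) x a := by
  obtain ⟨γ, hγ⟩ := h
  have hγX : ∀ t, γ.extend t ∈ X := fun t => by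
    obtain ⟨s, hs⟩ : γ.extend t ∈ range γ := by
      rw [← γ.extend_range]; exact mem_range_self t
    exact hs ▸ hγ s
  have hK : IsCompact (Icc (0 : ℝ) 1 ∩ γ.extend ⁻¹' H) :=
    isCompact_Icc.inter_right (hH.preimage γ.continuous_extend)
  obtain ⟨t, ⟨ht, htH⟩, hmin⟩ :=
    hK.exists_isLeast ⟨1, ⟨zero_le_one, le_rfl⟩, by simpa using hw⟩
  have hbefore : γ.extend '' Ico 0 t ⊆ univ \ H := by
    rintro _ ⟨s, hs, rfl⟩
    exact ⟨trivial, fun hsH => hs.2.not_ge (hmin ⟨⟨hs.1, hs.2.le.trans ht.2⟩, hsH⟩)⟩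
  refine ⟨γ.extend t, ⟨hγX t, htH⟩, ?_⟩
  have hsub : γ.extend '' Icc 0 t ⊆ X ∩ (H ∪ connectedComponentIn (univ \ H) z) := by
    rintro _ ⟨s, hs, rfl⟩
    refine ⟨hγX s, ?_⟩
    rcases hs.2.eq_or_lt with rfl | hst
    · exact Or.inl htH
    · have hx0 : x ∈ γ.extend '' Ico 0 t := ⟨0, ⟨le_rfl, hs.1.trans_lt hst⟩, by simp⟩
      have hxC : x ∈ connectedComponentIn (univ \ H) z := hx.resolve_left (hbefore hx0).2
      refine Or.inr ?_
      rw [connectedComponentIn_eq hxC]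
      exact (isPreconnected_Ico.image _ γ.continuous_extend.continuousOn).subset_connectedComponentIn
        hx0 hbefore ⟨s, ⟨hs.1, hst⟩, rfl⟩
  have hpc : IsPathConnected (γ.extend '' Icc 0 t) :=
    ((convex_Icc 0 t).isPathConnected (nonempty_Icc.2 ht.1)).image γ.continuous_extend
  exact (hpc.joinedIn x ⟨0, ⟨le_rfl, ht.1⟩, by simp⟩ _ ⟨t, ⟨ht.1, le_rfl⟩, rfl⟩).mono hsub

theorem IsPathConnected.inter_union_component {Y : Type*} [TopologicalSpace Y] {X H : Set Y}
    (hH : IsClosed H) (hX : IsPathConnected X) (hXH : (X ∩ H).Nonempty → IsPathConnected (X ∩ H))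
    {z : Y} (hne : (X ∩ (H ∪ connectedComponentIn (univ \ H) z)).Nonempty) :
    IsPathConnected (X ∩ (H ∪ connectedComponentIn (univ \ H) z)) := by
  refine isPathConnected_iff.2 ⟨hne, fun x hx y hy => ?_⟩
  by_cases hw : (X ∩ H).Nonempty
  · obtain ⟨w, hwX, hwH⟩ := hw
    obtain ⟨a, ha, hxa⟩ := (hX.joinedIn x hx.1 w hwX).exists_joinedIn_inter_union_component
      hH hwH hx.2
    obtain ⟨b, hb, hyb⟩ := (hX.joinedIn y hy.1 w hwX).exists_joinedIn_inter_union_component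
      hH hwH hy.2
    have hab : JoinedIn (X ∩ (H ∪ connectedComponentIn (univ \ H) z)) a b :=
      ((hXH ⟨w, hwX, hwH⟩).joinedIn a ha b hb).mono
        (inter_subset_inter_right X subset_union_left)
    exact (hxa.trans hab).trans hyb.symm
  · have hXc : X ⊆ univ \ H := fun u hu => ⟨trivial, fun huH => hw ⟨u, hu, huH⟩⟩
    have hxC := hx.2.resolve_left (hXc hx.1).2
    have hsub : X ⊆ connectedComponentIn (univ \ H) z := by
      rw [connectedComponentIn_eq hxC]
      exact hX.isConnected.isPreconnected.subset_connectedComponentIn hx.1 hXc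
    exact (hX.joinedIn x hx.1 y hy.1).mono fun u hu => ⟨hu, Or.inr (hsub hu)⟩

theorem IsPLSpace.isPathConnected {d k : ℕ} {X : Set (Eucl d)} (h : IsPLSpace k X) :
    IsPathConnected X := by
  obtain ⟨φ, -⟩ := h
  have huniv : PathConnectedSpace (univ : Set (Eucl k)) :=
    isPathConnected_iff_pathConnectedSpace.1 (convex_univ.isPathConnected univ_nonempty)
  exact isPathConnected_iff_pathConnectedSpace.2
    (φ.symm.surjective.pathConnectedSpace φ.symm.continuous)

theorem IsPseudohyperplaneIn.isClosed {d : ℕ} {H : Set (Eucl d)}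
    (h : IsPseudohyperplaneIn univ H) : IsClosed H :=
  isClosed_of_closure_subset (by simpa using h.2.1)

theorem IsAffineArrangement.isPathConnected_flat {d : ℕ} {ι : Type*} {H : ι → Set (Eucl d)}
    (hH : IsAffineArrangement H) (A : Set ι) (hne : (flat H A).Nonempty) :
    IsPathConnected (flat H A) := by
  rcases A.eq_empty_or_nonempty with rfl | hA
  · have huniv : IsPathConnected (univ : Set (Eucl d)) :=
      convex_univ.isPathConnected univ_nonempty
    simpa [flat] using huniv
  · rcases hH.subfamily A with h | h
    · exact absurd h hne.ne_empty
    · have := hA.to_subtype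
      obtain ⟨k, -, hk⟩ := h.flat_space univ univ_nonempty
      have hflat : flat (fun e : A => H e) univ = flat H A := by
        simp [flat, iInter_subtype]
      exact hflat ▸ hk.isPathConnected

theorem flat_insert {d : ℕ} {ι : Type*} (H : ι → Set (Eucl d)) (e : ι) (A : Set ι) :
    flat H (insert e A) = H e ∩ flat H A :=
  biInter_insert e A H

/-- Flats are included here because cutting `flat H A ∩ ⋂₀ 𝒯` with a closed side of `H e` needs
the induction hypothesis for `insert e A`. -/
theorem IsAffineArrangement.isPathConnected_flat_inter {d : ℕ} {ι : Type*}
    {H : ι → Set (Eucl d)} (hH : IsAffineArrangement H) {𝒯 : Set (Set (Eucl d))}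
    (hfin : 𝒯.Finite) (h𝒯 : ∀ S ∈ 𝒯, ∃ e, IsClosedSide (H e) S) (A : Set ι)
    (hne : (flat H A ∩ ⋂₀ 𝒯).Nonempty) : IsPathConnected (flat H A ∩ ⋂₀ 𝒯) := by
  induction 𝒯, hfin using Set.Finite.induction_on generalizing A with
  | empty =>
    rw [sInter_empty, inter_univ] at hne ⊢
    exact hH.isPathConnected_flat A hne
  | @insert S 𝒯 _ _ ih =>
    have ih := ih fun T hT => h𝒯 T (mem_insert_of_mem S hT)
    obtain ⟨e, C, ⟨z, -, rfl⟩, rfl⟩ := h𝒯 S (mem_insert S 𝒯)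
    rw [sInter_insert, inter_left_comm, inter_comm] at hne ⊢
    have hcut : flat H A ∩ ⋂₀ 𝒯 ∩ H e = flat H (insert e A) ∩ ⋂₀ 𝒯 := by
      rw [flat_insert, inter_assoc (H e), inter_comm (H e)]
    exact IsPathConnected.inter_union_component (hH.pseudohyperplane e).isClosed
      (ih A (hne.mono inter_subset_left)) (hcut ▸ ih (insert e A)) hne

theorem IsClosedSide.inter_subset {d : ℕ} {H S T : Set (Eucl d)} (hS : IsClosedSide H S)
    (hT : IsClosedSide H T) (hST : S ≠ T) : S ∩ T ⊆ H := by
  obtain ⟨_, ⟨y, -, rfl⟩, rfl⟩ := hS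
  obtain ⟨_, ⟨z, -, rfl⟩, rfl⟩ := hT
  rintro x ⟨hxS, hxT⟩
  by_contra hx
  refine hST ?_
  rw [connectedComponentIn_eq (hxS.resolve_left hx), connectedComponentIn_eq (hxT.resolve_left hx)]

/-- If each `H e` has finitely many closed sides this is trivial with `A = ∅`; in general, the
`H e` with more than one closed side in `𝒮` are put into `A`. -/
theorem exists_sInter_eq_flat_inter {d : ℕ} {ι : Type*} [Finite ι] (H : ι → Set (Eucl d))
    (𝒮 : Set (Set (Eucl d))) (h𝒮 : ∀ S ∈ 𝒮, ∃ e, IsClosedSide (H e) S) :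
    ∃ (A : Set ι) (𝒯 : Set (Set (Eucl d))), 𝒯 ⊆ 𝒮 ∧ 𝒯.Finite ∧ ⋂₀ 𝒮 = flat H A ∩ ⋂₀ 𝒯 := by
  let A : Set ι := {e | ∃ S ∈ 𝒮, ∃ T ∈ 𝒮, IsClosedSide (H e) S ∧ IsClosedSide (H e) T ∧ S ≠ T}
  let 𝒯 : ι → Set (Set (Eucl d)) := fun e => {S ∈ 𝒮 | e ∉ A ∧ IsClosedSide (H e) S}
  have hsub : ∀ e, (𝒯 e).Subsingleton := fun e S hS T hT => by
    by_contra hne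
    exact hS.2.1 ⟨S, hS.1, T, hT.1, hS.2.2, hT.2.2, hne⟩
  refine ⟨A, ⋃ e, 𝒯 e, iUnion_subset fun e S hS => hS.1, finite_iUnion fun e => (hsub e).finite,
    Subset.antisymm (fun x hx => ⟨?_, ?_⟩) ?_⟩
  · refine mem_iInter₂.2 fun e ⟨S, hS, T, hT, heS, heT, hne⟩ => ?_
    exact heS.inter_subset heT hne ⟨hx S hS, hx T hT⟩
  · exact fun S hS => by
      obtain ⟨e, he⟩ := mem_iUnion.1 hS
      exact hx S he.1
  · rintro x ⟨hxA, hxT⟩ S hS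
    obtain ⟨e, he⟩ := h𝒮 S hS
    by_cases heA : e ∈ A
    · obtain ⟨C, -, rfl⟩ := he
      exact Or.inl (mem_iInter₂.1 hxA e heA)
    · exact hxT S (mem_iUnion.2 ⟨e, hS, heA, he⟩)

theorem proposition5 {d : ℕ} {ι : Type*} (H : ι → Set (Eucl d)) (hH : IsAffineArrangement H)
    (𝒮 : Set (Set (Eucl d))) (h𝒮 : ∀ S ∈ 𝒮, ∃ e, IsClosedSide (H e) S) :
    (⋂₀ 𝒮).Nonempty → IsPathConnected (⋂₀ 𝒮) := by
  intro hne
  have := hH.finite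
  obtain ⟨A, 𝒯, hsub, hfin, heq⟩ := exists_sInter_eq_flat_inter H 𝒮 h𝒮
  rw [heq] at hne ⊢
  exact hH.isPathConnected_flat_inter hfin (fun S hS => h𝒮 S (hsub hS)) A hne
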